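/- All monads and functors are on the category $\mathsf{Set}$ of sets. A monad $\mathbb S=(S,\eta,\mu)$ is *consistent* if $\eta_X$ is injective for every set $X$. A *free monad* on an endofunctor $H$ is a monad $\mathbb F_H$ with a natural transformation $\gamma:H\to F_H$ that is initial among all pairs $(\mathbb T,\ \lambda:H\to T)$ with $\mathbb T$ a monad. The *coproduct* $\mathbb S\oplus\mathbb T$ is the coproduct in the category of monads and monad morphisms. A cardinal $\lambda$ is a *fixpoint* of $H$ if $\operatorname{card}H\lambda=\lambda$; $S$ and $H$ have *arbitrarily large joint fixpoints* if for every cardinal $\beta$ there is a cardinal $\lambda\ge\beta$ that is a fixpoint of both. For a set $E$ the *exception monad* is $\mathbb M_E:X\mapsto X+E$. The *Trnková closure* of a set functor $S$ is the functor $\hat S$ that agrees with $S$ on nonempty sets and functions between them and for which $\hat S\emptyset$ is the equalizer of the two maps $S1\rightrightarrows S2$ induced by the two maps $1\rightrightarrows 2$; if $\mathbb S$ is a monad, $\hat S$ carries a unique monad structure for which the canonical transformation $S\to\hat S$ is a monad morphism. The monad $\mathbb S$ is *substantially exceptional* if its Trnková closure is isomorphic, as a monad, to $\mathbb M_E$ for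 some set $E$. A monad is *finitary* if its underlying functor preserves filtered colimits. 1. Let $\mathbb S$ be a consistent monad and let $\mathbb F_H$ be a free monad on an endofunctor $H$. Then the coproduct $\mathbb S\oplus\mathbb F_H$ exists if and only if $S$ and $H$ have arbitrarily large joint fixpoints or at least one of the monads $\mathbb S$, $\mathbb F_H$ is substantially exceptional. 2. For every finitary monad $\mathbb S$ (consistent or not) and every free monad $\mathbb F_H$, the coproduct $\mathbb S\oplus\mathbb F_H$ exists. -/

import Mathlib

universe u

open CategoryTheory

namespace MonadCoproduct

/-- A monad on sets is consistent when all components of its unit are injective. -/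
def Consistent (S : Monad (Type u)) : Prop :=
  ∀ X : Type u, Function.Injective (S.η.app X)

/-- `(F, γ)` is a free monad on the endofunctor `H`: it is initial among all pairs consisting of
a monad `T` and a natural transformation from `H` to the underlying functor of `T`. -/
def IsFreeMonad (H : Type u ⥤ Type u) (F : Monad (Type u)) (γ : H ⟶ F.toFunctor) : Prop :=
  ∀ (T : Monad (Type u)) (t : H ⟶ T.toFunctor),
    ∃! φ : F ⟶ T, γ ≫ φ.toNatTrans = t

/-- The cardinal `c` is a fixpoint of the set functor `H`, i.e. `card (H c) = c`. -/
def IsFixpoint (H : Type u ⥤ Type u) (c : Cardinal.{u}) : Prop :=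
  Cardinal.mk (H.obj c.out) = c

/-- `H` and `K` have arbitrarily large joint fixpoints. -/
def HaveArbitrarilyLargeJointFixpoints (H K : Type u ⥤ Type u) : Prop :=
  ∀ b : Cardinal.{u}, ∃ c : Cardinal.{u}, b ≤ c ∧ IsFixpoint H c ∧ IsFixpoint K c

/-- The exception monad `X ↦ X + E`. -/
def exceptionMonad (E : Type u) : Monad (Type u) where
  obj X := X ⊕ E
  map f := ↾(Sum.map f id)
  map_id X := by ext x; cases x <;> rfl
  map_comp f g := by ext x; cases x <;> rfl
  η := { app := fun X => ↾Sum.inl, naturality := fun X Y f => by ext x; rfl }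
  μ := { app := fun X => ↾(Sum.elim id Sum.inr)
         naturality := fun X Y f => by ext x; rcases x with (x | x) | x <;> rfl }
  assoc X := by ext x; rcases x with ((x | x) | x) | x <;> rfl
  left_unit X := by ext x; cases x <;> rfl
  right_unit X := by ext x; cases x <;> rfl

/-- The action of a set functor on a plain function. -/
def fmap (H : Type u ⥤ Type u) {X Y : Type u} (f : X → Y) : H.obj X → H.obj Y :=
  fun a => H.map (↾f) a

theorem fmap_id (H : Type u ⥤ Type u) {X : Type u} (a : H.obj X) : fmap H (fun x => x) a = a :=
  congrArg (fun g : H.obj X ⟶ H.obj X => g a) (H.map_id X)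

theorem fmap_fmap (H : Type u ⥤ Type u) {X Y Z : Type u} (f : X → Y) (g : Y → Z)
    (a : H.obj X) : fmap H g (fmap H f a) = fmap H (fun x => g (f x)) a :=
  (congrArg (fun h : H.obj X ⟶ H.obj Z => h a) (H.map_comp (↾f) (↾g))).symm

/-- The unit of a monad, as a function. -/
def unit (S : Monad (Type u)) {X : Type u} (x : X) : S.obj X := S.η.app X x

/-- The Kleisli extension `μ ∘ S f` of `f`, applied to an element. -/
def bind (S : Monad (Type u)) {X Y : Type u} (a : S.obj X) (f : X → S.obj Y) : S.obj Y :=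
  S.μ.app Y (fmap S.toFunctor f a)

theorem fmap_unit (S : Monad (Type u)) {X Y : Type u} (f : X → Y) (x : X) :
    fmap S.toFunctor f (unit S x) = unit S (f x) :=
  (congrArg (fun h : X ⟶ S.obj Y => h x) (S.η.naturality (↾f))).symm

theorem fmap_mu (S : Monad (Type u)) {X Y : Type u} (f : X → Y) (a : S.obj (S.obj X)) :
    fmap S.toFunctor f (S.μ.app X a) = S.μ.app Y (fmap S.toFunctor (fmap S.toFunctor f) a) :=
  (congrArg (fun h : S.obj (S.obj X) ⟶ S.obj Y => h a) (S.μ.naturality (↾f))).symm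

theorem fmap_bind (S : Monad (Type u)) {X Y Z : Type u} (g : Y → Z) (f : X → S.obj Y)
    (a : S.obj X) :
    fmap S.toFunctor g (bind S a f) = bind S a (fun x => fmap S.toFunctor g (f x)) := by
  unfold bind
  rw [fmap_mu, fmap_fmap]

theorem bind_fmap (S : Monad (Type u)) {X Y Z : Type u} (g : X → Y) (f : Y → S.obj Z)
    (a : S.obj X) :
    bind S (fmap S.toFunctor g a) f = bind S a (fun x => f (g x)) := by
  unfold bind
  rw [fmap_fmap]

theorem unit_bind (S : Monad (Type u)) {X Y : Type u} (x : X) (f : X → S.obj Y) :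
    bind S (unit S x) f = f x := by
  unfold bind
  rw [fmap_unit]
  exact congrArg (fun h : S.obj Y ⟶ S.obj Y => h (f x)) (S.left_unit Y)

theorem bind_unit (S : Monad (Type u)) {X : Type u} (a : S.obj X) :
    bind S a (fun x => unit S x) = a :=
  congrArg (fun h : S.obj X ⟶ S.obj X => h a) (S.right_unit X)

theorem bind_bind (S : Monad (Type u)) {X Y Z : Type u} (a : S.obj X) (f : X → S.obj Y)
    (g : Y → S.obj Z) : bind S (bind S a f) g = bind S a (fun x => bind S (f x) g) := by
  have h := congrArg (fun h : S.obj (S.obj (S.obj Z)) ⟶ S.obj Z =>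
    h (fmap S.toFunctor (fun x => fmap S.toFunctor g (f x)) a)) (S.assoc Z)
  change S.μ.app Z (fmap S.toFunctor (fun c => S.μ.app Z c) _) = S.μ.app Z (S.μ.app (S.obj Z) _) at h
  rw [fmap_fmap] at h
  unfold bind
  rw [fmap_mu, fmap_fmap]
  exact h.symm

/-- The value at `X` of the Trnková closure of `H`: the equalizer of `H v₁` and `H v₂`, where
`v₁, v₂ : X + 1 → X + 2` are the two injections that extend the inclusion of `X`. For empty `X`
this is the equalizer of the two maps `H 1 → H 2`; for nonempty `X` it is a copy of `H X`
(see `trnkovaUnit_bijective`). -/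
@[ext]
structure TrnkovaObj (H : Type u ⥤ Type u) (X : Type u) : Type u where
  val : H.obj (Option X)
  property : fmap H (Option.map some) val = fmap H some val

/-- The Trnková closure of a set functor. -/
def trnkovaFunctor (H : Type u ⥤ Type u) : Type u ⥤ Type u where
  obj X := TrnkovaObj H X
  map {X Y} f := ↾fun a => ⟨fmap H (Option.map f) a.val, by
    have h := congrArg (fmap H (Option.map (Option.map f))) a.property
    simp only [fmap_fmap] at h ⊢
    convert h using 2
    all_goals (ext x : 1; cases x <;> rfl)⟩
  map_id X := by
    ext a
    refine Eq.trans ?_ (fmap_id H a.val)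
    change fmap H _ a.val = _
    congr 1
    ext x : 1
    cases x <;> rfl
  map_comp {X Y Z} f g := by
    ext a
    refine Eq.trans ?_ (fmap_fmap H (Option.map f) (Option.map g) a.val).symm
    change fmap H _ a.val = _
    congr 1
    ext x : 1
    cases x <;> rfl

/-- The comparison map `r` from `H` to its Trnková closure. -/
def trnkovaUnit (H : Type u ⥤ Type u) : H ⟶ trnkovaFunctor H where
  app X := ↾fun a => ⟨fmap H some a, by rw [fmap_fmap, fmap_fmap]; rfl⟩
  naturality X Y f := by
    ext a
    change TrnkovaObj.mk _ _ = TrnkovaObj.mk _ _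
    congr 1
    exact (fmap_fmap H f some a).trans (fmap_fmap H some (Option.map f) a).symm

theorem trnkovaUnit_bijective (H : Type u ⥤ Type u) (X : Type u) [Nonempty X] :
    Function.Bijective ((trnkovaUnit H).app X) := by
  obtain ⟨x₀⟩ := ‹Nonempty X›
  constructor
  · intro a b h
    have h' : fmap H some a = fmap H some b := congrArg TrnkovaObj.val h
    have h'' := congrArg (fmap H (fun o : Option X => o.getD x₀)) h'
    simp only [fmap_fmap] at h''
    exact (fmap_id H a).symm.trans (h''.trans (fmap_id H b))
  · intro a
    refine ⟨fmap H (fun o : Option X => o.getD x₀) a.val, TrnkovaObj.ext ?_⟩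
    change fmap H some (fmap H (fun o : Option X => o.getD x₀) a.val) = a.val
    have h := congrArg (fmap H (fun o : Option (Option X) => o.getD (some x₀))) a.property
    simp only [fmap_fmap] at h
    rw [fmap_fmap]
    refine Eq.trans ?_ (h.trans (fmap_id H a.val))
    congr 1
    ext x : 1
    cases x <;> rfl

/-- The substitution used for the multiplication of the Trnková closure. -/
def trnkovaSubst (S : Monad (Type u)) (X : Type u) :
    Option (TrnkovaObj S.toFunctor X) → S.obj (Option X)
  | none => unit S none
  | some a => a.val

theorem trnkovaSubst_condition (S : Monad (Type u)) (X : Type u)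
    (w : TrnkovaObj S.toFunctor (TrnkovaObj S.toFunctor X)) :
    fmap S.toFunctor (Option.map some) (bind S w.val (trnkovaSubst S X)) =
      fmap S.toFunctor some (bind S w.val (trnkovaSubst S X)) := by
  let c : Option (Option (TrnkovaObj S.toFunctor X)) → S.obj (Option (Option X)) := fun o =>
    match o with
    | none => unit S none
    | some none => unit S (some none)
    | some (some a) => fmap S.toFunctor some a.val
  have h := congrArg (fun a => bind S a c) w.property
  simp only [bind_fmap] at h
  rw [fmap_bind, fmap_bind]
  refine Eq.trans ?_ (h.trans ?_)
  · congr 1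
    ext o : 1
    cases o with
    | none => exact fmap_unit S _ _
    | some a => exact a.property
  · congr 1
    ext o : 1
    cases o with
    | none => exact (fmap_unit S _ _).symm
    | some a => rfl

/-- The Trnková closure of a monad: the monad structure on the Trnková closure of the underlying
functor for which the comparison map is a monad morphism (`trnkovaUnitHom`). -/
def trnkovaMonad (S : Monad (Type u)) : Monad (Type u) where
  toFunctor := trnkovaFunctor S.toFunctor
  η := S.η ≫ trnkovaUnit S.toFunctor
  μ :=
    { app := fun X => ↾fun w => ⟨bind S w.val (trnkovaSubst S X), trnkovaSubst_condition S X w⟩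
      naturality := fun X Y f => by
        ext w
        refine TrnkovaObj.ext ?_
        refine (bind_fmap S (Option.map _) (trnkovaSubst S Y) (TrnkovaObj.val w)).trans
          (Eq.trans ?_ (fmap_bind S (Option.map f) (trnkovaSubst S X) (TrnkovaObj.val w)).symm)
        congr 1
        ext o : 1
        cases o with
        | none => exact (fmap_unit S (Option.map f) none).symm
        | some a => rfl }
  assoc X := by
    ext w
    refine TrnkovaObj.ext ?_
    refine (bind_fmap S (Option.map _) (trnkovaSubst S X) (TrnkovaObj.val w)).trans
      (Eq.trans ?_ (bind_bind S (TrnkovaObj.val w) (trnkovaSubst S _) (trnkovaSubst S X)).symm)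
    congr 1
    ext o : 1
    cases o with
    | none => exact (unit_bind S none (trnkovaSubst S X)).symm
    | some a => rfl
  left_unit X := by
    ext a
    refine TrnkovaObj.ext ?_
    exact (bind_fmap S some (trnkovaSubst S X) (unit S a)).trans (unit_bind S a _)
  right_unit X := by
    ext a
    refine TrnkovaObj.ext ?_
    refine (bind_fmap S (Option.map _) (trnkovaSubst S X) (TrnkovaObj.val a)).trans
      (Eq.trans ?_ (bind_unit S (TrnkovaObj.val a)))
    congr 1
    ext o : 1
    cases o with
    | none => rfl
    | some x => exact fmap_unit S some x

/-- The comparison map is a monad morphism. -/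
def trnkovaUnitHom (S : Monad (Type u)) : S ⟶ trnkovaMonad S where
  toNatTrans := trnkovaUnit S.toFunctor
  app_η X := rfl
  app_μ X := by
    ext w
    refine TrnkovaObj.ext ?_
    change fmap S.toFunctor some (S.μ.app X w) =
      bind S (fmap S.toFunctor some (fmap S.toFunctor _ w)) _
    rw [bind_fmap, bind_fmap, fmap_mu]
    rfl

/-- A monad is exceptional when it is isomorphic to an exception monad, and substantially
exceptional when its Trnková closure is exceptional. -/
def SubstantiallyExceptional (S : Monad (Type u)) : Prop :=
  ∃ E : Type u, Nonempty (trnkovaMonad S ≅ exceptionMonad E)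

end MonadCoproduct

namespace MonadCoproduct

/-! ### Monads on sets in Kleisli form -/

/-! As `F` is free on `H`, a cocone over `S` and `F` amounts to a monad morphism out of `S` and a
natural transformation out of `H` (`hasBinaryCoproduct_iff`). The universal such cocone is built
from free bialgebras (`exists_isCopair`), and the free bialgebra on `X` is `S Y` for `Y` an initial
algebra of `Z ↦ X + H (S Z)` (`exists_free_of_initial`). An initial algebra exists once some algebra
has an injective structure map (`exists_isInitialAlgebra`), so arbitrarily large infinite `Z` with
`card H (S Z) ≤ card Z` suffice (`exists_isCopair_of_card_le`). Joint fixpoints are such `Z`. If `S`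
does not increase large cardinals (`S` substantially exceptional or finitary), sets `Z = F Y` work,
since `F Y ≅ Y + H (F Y)`. If `F` is substantially exceptional, `H` is bounded on nonempty sets and
every large `Z` works.

Conversely, a coproduct `P` satisfies `P X ≅ S (X + H (P X))` (`IsCopair.bijective_eval`). If `H` is
constant on nonempty sets, `F` is substantially exceptional. Otherwise `H` does not decrease large
cardinals (`le_mk_obj`), and consistency of `S` squeezes `P X`, `H (P X)` and `X + H (P X)` to one
cardinality, which is a joint fixpoint for large `X` (`IsCopair.fixpoints`). -/

theorem fmap_eq_bind (S : Monad (Type u)) {X Y : Type u} (f : X → Y) (a : S.obj X) :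
    fmap S.toFunctor f a = bind S a (fun x => unit S (f x)) := by
  have h := fmap_bind S f (fun x => unit S x) a
  rw [bind_unit] at h
  simpa only [fmap_unit] using h

/-- A monad on sets from a Kleisli triple. -/
def monadOfBind (M : Type u → Type u) (ret : ∀ X : Type u, X → M X)
    (ext : ∀ X Y : Type u, (X → M Y) → M X → M Y)
    (ext_ret : ∀ (X Y : Type u) (f : X → M Y) (x : X), ext X Y f (ret X x) = f x)
    (ret_ext : ∀ (X : Type u) (a : M X), ext X X (ret X) a = a)
    (ext_ext : ∀ (X Y Z : Type u) (f : X → M Y) (g : Y → M Z) (a : M X),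
      ext Y Z g (ext X Y f a) = ext X Z (fun x => ext Y Z g (f x)) a) : Monad (Type u) where
  obj := M
  map {X Y} f := ↾(ext X Y (fun x => ret Y (f x)))
  map_id X := by
    ext a
    exact ret_ext X a
  map_comp {X Y Z} f g := by
    ext a
    refine Eq.trans ?_ (ext_ext X Y Z _ _ a).symm
    change ext X Z _ a = ext X Z _ a
    simp only [ext_ret]
    rfl
  η := { app := fun X => ↾(ret X), naturality := fun X Y f => by
          ext x
          exact (ext_ret X Y _ x).symm }
  μ := { app := fun X => ↾(ext (M X) X (fun a => a)), naturality := fun X Y f => by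
          ext a
          refine (ext_ext _ _ _ _ _ a).trans (Eq.trans ?_ (ext_ext _ _ _ _ _ a).symm)
          simp only [ext_ret]
          rfl }
  assoc X := by
    ext a
    refine (ext_ext _ _ _ _ _ a).trans (Eq.trans ?_ (ext_ext _ _ _ _ _ a).symm)
    simp only [ext_ret]
    rfl
  left_unit X := by
    ext a
    exact ext_ret _ _ _ a
  right_unit X := by
    ext a
    refine (ext_ext _ _ _ _ _ a).trans ?_
    simp only [ext_ret]
    exact ret_ext X a

theorem bind_monadOfBind {M : Type u → Type u} {ret : ∀ X : Type u, X → M X}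
    {ext : ∀ X Y : Type u, (X → M Y) → M X → M Y}
    {ext_ret : ∀ (X Y : Type u) (f : X → M Y) (x : X), ext X Y f (ret X x) = f x}
    {ret_ext : ∀ (X : Type u) (a : M X), ext X X (ret X) a = a}
    {ext_ext : ∀ (X Y Z : Type u) (f : X → M Y) (g : Y → M Z) (a : M X),
      ext Y Z g (ext X Y f a) = ext X Z (fun x => ext Y Z g (f x)) a}
    {X Y : Type u} (a : M X) (f : X → M Y) :
    bind (monadOfBind M ret ext ext_ret ret_ext ext_ext) a f = ext X Y f a := by
  refine (ext_ext _ _ _ _ _ a).trans ?_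
  exact congrArg (fun g => ext X Y g a) (funext fun x => ext_ret _ _ _ _)

/-- The action of a monad morphism on elements. -/
def ev {S T : Monad (Type u)} (φ : S ⟶ T) {X : Type u} (a : S.obj X) : T.obj X :=
  φ.toNatTrans.app X a

/-- The action of a natural transformation on elements. -/
def nev {H K : Type u ⥤ Type u} (t : H ⟶ K) {X : Type u} (a : H.obj X) : K.obj X :=
  t.app X a

theorem nev_fmap {H K : Type u ⥤ Type u} (t : H ⟶ K) {X Y : Type u} (f : X → Y) (a : H.obj X) :
    nev t (fmap H f a) = fmap K f (nev t a) :=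
  congrArg (fun h : H.obj X ⟶ K.obj Y => h a) (t.naturality (↾f))

theorem ev_fmap {S T : Monad (Type u)} (φ : S ⟶ T) {X Y : Type u} (f : X → Y) (a : S.obj X) :
    ev φ (fmap S.toFunctor f a) = fmap T.toFunctor f (ev φ a) :=
  nev_fmap φ.toNatTrans f a

theorem ev_unit {S T : Monad (Type u)} (φ : S ⟶ T) {X : Type u} (x : X) :
    ev φ (unit S x) = unit T x :=
  congrArg (fun h : X ⟶ T.obj X => h x) (φ.app_η X)

theorem ev_bind {S T : Monad (Type u)} (φ : S ⟶ T) {X Y : Type u} (a : S.obj X)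
    (f : X → S.obj Y) : ev φ (bind S a f) = bind T (ev φ a) (fun x => ev φ (f x)) := by
  have h := congrArg (fun h : S.obj (S.obj Y) ⟶ T.obj Y => h (fmap S.toFunctor f a)) (φ.app_μ Y)
  refine h.trans ?_
  change T.μ.app Y (ev φ (fmap S.toFunctor (fun b => ev φ b) (fmap S.toFunctor f a))) = _
  rw [fmap_fmap, ev_fmap]
  rfl

theorem ev_comp {S T U : Monad (Type u)} (φ : S ⟶ T) (ψ : T ⟶ U) {X : Type u} (a : S.obj X) :
    ev (φ ≫ ψ) a = ev ψ (ev φ a) := rfl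

theorem ev_id {S : Monad (Type u)} {X : Type u} (a : S.obj X) : ev (𝟙 S) a = a := rfl

theorem hom_ext {S T : Monad (Type u)} {φ ψ : S ⟶ T}
    (h : ∀ (X : Type u) (a : S.obj X), ev φ a = ev ψ a) : φ = ψ := by
  apply MonadHom.ext'
  funext X
  ext a
  exact h X a

theorem nat_ext {H K : Type u ⥤ Type u} {s t : H ⟶ K}
    (h : ∀ (X : Type u) (a : H.obj X), nev s a = nev t a) : s = t := by
  ext X a
  exact h X a

/-- A natural transformation from its action on elements. -/
def natOf {H K : Type u ⥤ Type u} (φ : ∀ X : Type u, H.obj X → K.obj X)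
    (h : ∀ (X Y : Type u) (f : X → Y) (a : H.obj X), φ Y (fmap H f a) = fmap K f (φ X a)) :
    H ⟶ K where
  app X := ↾(φ X)
  naturality X Y f := by
    ext a
    exact h X Y f a

/-- A monad morphism from a family of maps compatible with units and Kleisli extension. -/
def homOf {S T : Monad (Type u)} (φ : ∀ X : Type u, S.obj X → T.obj X)
    (hu : ∀ (X : Type u) (x : X), φ X (unit S x) = unit T x)
    (hb : ∀ (X Y : Type u) (a : S.obj X) (f : X → S.obj Y),
      φ Y (bind S a f) = bind T (φ X a) (fun x => φ Y (f x))) : S ⟶ T :=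
  { natOf (H := S.toFunctor) (K := T.toFunctor) φ (fun X Y f a => by
      rw [fmap_eq_bind, fmap_eq_bind, hb]
      simp only [hu]) with
    app_η := fun X => by
      ext x
      exact hu X x
    app_μ := fun X => by
      ext a
      have h := hb _ _ a (fun b => b)
      refine (Eq.trans ?_ h).trans ?_
      · change φ X (S.μ.app X a) = φ X (S.μ.app X (fmap S.toFunctor (fun b => b) a))
        rw [fmap_id]
      · change _ = T.μ.app X (φ _ (fmap S.toFunctor (φ X) a))
        rw [fmap_eq_bind, hb, bind, fmap_eq_bind]
        simp only [hu] }

/-! ### Initial algebras -/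

/-- `(Y, y)` is an initial algebra of the set functor `G`. -/
def IsInitialAlgebra (G : Type u ⥤ Type u) (Y : Type u) (y : G.obj Y → Y) : Prop :=
  ∀ (B : Type u) (b : G.obj B → B), ∃! k : Y → B, ∀ w, k (y w) = b (fmap G k w)

/-- The operator on subsets of an algebra whose prefixed points are the subalgebras. -/
def subalgStep (G : Type u ⥤ Type u) {A : Type u} (a : G.obj A → A) : Set A →o Set A where
  toFun R := Set.range fun r : G.obj R => a (fmap G Subtype.val r)
  monotone' R R' h := by
    rintro _ ⟨r, rfl⟩
    refine ⟨fmap G (Set.inclusion h) r, ?_⟩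
    simp only [fmap_fmap]

/-- The least subalgebra of `Z × B` will be the graph of the homomorphism to `B`; this is its
single-valuedness. It propagates along the transfinite iteration because `a` is injective. -/
theorem fst_injOn_lfp (G : Type u ⥤ Type u) {Z B : Type u} (a : G.obj Z → Z)
    (ha : Function.Injective a) (b : G.obj B → B) :
    Set.InjOn Prod.fst (OrderHom.lfp
      (subalgStep G (A := Z × B) fun w => (a (fmap G Prod.fst w), b (fmap G Prod.snd w)))) := by
  set Φ := subalgStep G (A := Z × B) fun w => (a (fmap G Prod.fst w), b (fmap G Prod.snd w))
  have step : ∀ R : Set (Z × B), Set.InjOn Prod.fst R → Set.InjOn Prod.fst (Φ R) := by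
    rintro R hR _ ⟨r, rfl⟩ _ ⟨r', rfl⟩ h
    have h₁ := ha h
    simp only [fmap_fmap] at h₁
    have : Nonempty B := ⟨b (fmap G Prod.snd (fmap G (Subtype.val : R → Z × B) r))⟩
    have hinj : Function.Injective fun x : R => x.1.1 :=
      fun x y hxy => Subtype.ext (hR x.2 y.2 hxy)
    obtain ⟨k, hk⟩ : ∃ k : Z → B, ∀ x : R, k x.1.1 = x.1.2 :=
      ⟨Function.extend (fun x : R => x.1.1) (fun x => x.1.2) fun _ => Classical.arbitrary B,
        fun x => hinj.extend_apply _ _ x⟩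
    have h₂ := congrArg (fmap G k) h₁
    simp only [fmap_fmap, hk] at h₂
    refine Prod.ext h ?_
    simp only [fmap_fmap]
    exact congrArg b h₂
  have approx : ∀ o, Set.InjOn Prod.fst (OrdinalApprox.lfpApprox Φ ⊥ o) := by
    intro o
    induction o using WellFoundedLT.induction with | ind o ih
    intro p hp q hq h
    rw [OrdinalApprox.lfpApprox] at hp hq
    simp only [Set.bot_eq_empty, Set.sup_eq_union, Set.empty_union, Set.iSup_eq_iUnion,
      Set.mem_iUnion] at hp hq
    obtain ⟨i, hi, hp⟩ := hp
    obtain ⟨j, hj, hq⟩ := hq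
    -- The stages form a chain, so both points already lie in `Φ` of the later of the two stages.
    refine step _ (ih (max i j) (max_lt hi hj)) ?_ ?_ h
    · exact Φ.monotone (OrdinalApprox.lfpApprox_mono_right Φ (le_max_left i j)) hp
    · exact Φ.monotone (OrdinalApprox.lfpApprox_mono_right Φ (le_max_right i j)) hq
  rw [← OrdinalApprox.lfpApprox_ord_eq_lfp]
  exact approx _

/-- A set functor with an algebra whose structure map is injective has an initial algebra. -/
theorem exists_isInitialAlgebra (G : Type u ⥤ Type u) {Z : Type u} (a : G.obj Z → Z)
    (ha : Function.Injective a) : ∃ (Y : Type u) (y : G.obj Y → Y), IsInitialAlgebra G Y y := by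
  -- The initial algebra is the least subalgebra of `Z`, and the homomorphism to `B` has as its
  -- graph the least subalgebra `R` of `Z × B`.
  set I := OrderHom.lfp (subalgStep G a)
  have hI : subalgStep G a I ≤ I := (OrderHom.map_lfp _).le
  let y : G.obj I → I := fun w => ⟨a (fmap G Subtype.val w), hI ⟨w, rfl⟩⟩
  refine ⟨I, y, fun B b => ?_⟩
  set Φ := subalgStep G (A := Z × B) fun w => (a (fmap G Prod.fst w), b (fmap G Prod.snd w))
    with hΦ
  set R := OrderHom.lfp Φ
  have hR : Φ R ≤ R := (OrderHom.map_lfp _).le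
  have hinj : Set.InjOn Prod.fst R := fst_injOn_lfp G a ha b
  have htot : I ≤ Prod.fst '' R := by
    refine OrderHom.lfp_le _ ?_
    rintro _ ⟨r, rfl⟩
    choose s hs using fun e : Prod.fst '' R => e.2
    refine ⟨_, hR ⟨fmap G (fun e => ⟨s e, (hs e).1⟩) r, rfl⟩, ?_⟩
    simp only [fmap_fmap, (hs _).2]
  choose s hs using fun e : I => htot e.2
  have hk : ∀ (z : I) (c : B), (z.1, c) ∈ R → (s z).2 = c := fun z c hc =>
    congrArg Prod.snd (hinj (hs z).1 hc (hs z).2)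
  refine ⟨fun z => (s z).2, fun w => hk _ _ ?_, fun k' hk' => ?_⟩
  · have := hR ⟨fmap G (fun e => ⟨s e, (hs e).1⟩) w, rfl⟩
    simp only [fmap_fmap, (hs _).2] at this
    exact this
  · have : I ≤ {z | ∀ h : z ∈ I, k' ⟨z, h⟩ = (s ⟨z, h⟩).2} ∩ I := by
      refine OrderHom.lfp_le _ ?_
      rintro _ ⟨r, rfl⟩
      have hmem : a (fmap G Subtype.val r) ∈ I := by
        refine hI ⟨fmap G (fun e => ⟨e.1, e.2.2⟩) r, ?_⟩
        simp only [fmap_fmap]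
      refine ⟨fun h => ?_, hmem⟩
      have e : (⟨a (fmap G Subtype.val r), h⟩ : I) = y (fmap G (fun e => ⟨e.1, e.2.2⟩) r) := by
        refine Subtype.ext ?_
        simp only [y, fmap_fmap]
      simp only [e]
      rw [hk', fmap_fmap]
      refine (hk _ _ ?_).symm
      have := hR ⟨fmap G (fun e => ⟨(e.1, k' ⟨e.1, e.2.2⟩), by
        rw [e.2.1 e.2.2]
        have h₁ := (hs ⟨e.1, e.2.2⟩).1
        have h₂ := (hs ⟨e.1, e.2.2⟩).2
        rwa [show s ⟨e.1, e.2.2⟩ = (e.1, (s ⟨e.1, e.2.2⟩).2) from Prod.ext h₂ rfl] at h₁⟩) r, rfl⟩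
      simp only [fmap_fmap] at this
      simpa only [y, fmap_fmap] using this
    funext z
    exact (this z.2).1 z.2

/-! ### Bialgebras and the coproduct -/

/-- A bialgebra: an Eilenberg–Moore algebra structure for `S` and an algebra structure for `H` on
the set `A`. -/
structure Bialgebra (S : Monad (Type u)) (H : Type u ⥤ Type u) (A : Type u) where
  /-- The algebra structure for the monad. -/
  act : S.obj A → A
  /-- The algebra structure for the functor. -/
  op : H.obj A → A
  act_unit : ∀ x, act (unit S x) = x
  act_bind : ∀ (X : Type u) (a : S.obj X) (f : X → S.obj A),
    act (bind S a f) = act (fmap S.toFunctor (fun x => act (f x)) a)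

/-- Homomorphisms of bialgebras. -/
structure Bialgebra.IsHom {S : Monad (Type u)} {H : Type u ⥤ Type u} {A B : Type u}
    (α : Bialgebra S H A) (β : Bialgebra S H B) (f : A → B) : Prop where
  map_act : ∀ a, f (α.act a) = β.act (fmap S.toFunctor f a)
  map_op : ∀ w, f (α.op w) = β.op (fmap H f w)

theorem Bialgebra.IsHom.comp {S : Monad (Type u)} {H : Type u ⥤ Type u} {A B C : Type u}
    {α : Bialgebra S H A} {β : Bialgebra S H B} {δ : Bialgebra S H C} {f : A → B} {g : B → C}
    (hg : IsHom β δ g) (hf : IsHom α β f) : IsHom α δ fun x => g (f x) where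
  map_act a := by rw [hf.map_act, hg.map_act, fmap_fmap]
  map_op w := by rw [hf.map_op, hg.map_op, fmap_fmap]

theorem Bialgebra.isHom_id {S : Monad (Type u)} {H : Type u ⥤ Type u} {A : Type u}
    (α : Bialgebra S H A) : IsHom α α fun x => x where
  map_act a := by rw [fmap_id]
  map_op w := by rw [fmap_id]

/-- `A` is a free bialgebra on the set `X`, with universal map `i`. -/
def Bialgebra.IsFree {S : Monad (Type u)} {H : Type u ⥤ Type u} {A : Type u}
    (α : Bialgebra S H A) {X : Type u} (i : X → A) : Prop :=
  ∀ (B : Type u) (β : Bialgebra S H B) (f : X → B), ∃! g, IsHom α β g ∧ ∀ x, g (i x) = f x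

theorem Bialgebra.IsFree.hom_ext {S : Monad (Type u)} {H : Type u ⥤ Type u} {A : Type u}
    {α : Bialgebra S H A} {X : Type u} {i : X → A} (h : α.IsFree i) {B : Type u}
    {β : Bialgebra S H B} {g g' : A → B} (hg : IsHom α β g) (hg' : IsHom α β g')
    (e : ∀ x, g (i x) = g' (i x)) (a : A) : g a = g' a :=
  congrFun ((h B β fun x => g' (i x)).unique ⟨hg, e⟩ ⟨hg', fun _ => rfl⟩) a

/-- `P`, with `s` and `t`, is initial among the monads that receive a monad morphism from `S` and
a natural transformation from `H`. -/
def IsCopair (S : Monad (Type u)) (H : Type u ⥤ Type u) (P : Monad (Type u)) (s : S ⟶ P)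
    (t : H ⟶ P.toFunctor) : Prop :=
  ∀ (T : Monad (Type u)) (s' : S ⟶ T) (t' : H ⟶ T.toFunctor),
    ∃! φ : P ⟶ T, s ≫ φ = s' ∧ t ≫ φ.toNatTrans = t'

/-- Precomposition with `γ` is a bijection from morphisms `F ⟶ T` to transformations from `H` to
`T`, so both universal properties say the same. -/
theorem hasBinaryCoproduct_iff {S F : Monad (Type u)} {H : Type u ⥤ Type u}
    {γ : H ⟶ F.toFunctor} (hF : IsFreeMonad H F γ) :
    Limits.HasBinaryCoproduct S F ↔ ∃ P s t, IsCopair S H P s t := by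
  constructor
  · intro _
    refine ⟨S ⨿ F, Limits.coprod.inl, γ ≫ (Limits.coprod.inr : F ⟶ S ⨿ F).toNatTrans, ?_⟩
    intro T s' t'
    obtain ⟨f, hf, hu⟩ := hF T t'
    refine ⟨Limits.coprod.desc s' f, ⟨Limits.coprod.inl_desc _ _, ?_⟩, ?_⟩
    · have := congrArg MonadHom.toNatTrans (Limits.coprod.inr_desc s' f)
      exact (Category.assoc _ _ _).trans ((congrArg (γ ≫ ·) this).trans hf)
    · rintro ψ ⟨h₁, h₂⟩
      apply Limits.coprod.hom_ext
      · rw [h₁, Limits.coprod.inl_desc]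
      · rw [Limits.coprod.inr_desc]
        exact hu _ ((Category.assoc _ _ _).symm.trans h₂)
  · rintro ⟨P, s, t, hP⟩
    obtain ⟨r, hr, -⟩ := hF P t
    refine ⟨⟨Limits.BinaryCofan.mk s r, ?_⟩⟩
    have key : ∀ (T : Monad (Type u)) (f : S ⟶ T) (g : F ⟶ T),
        ∃! m : P ⟶ T, s ≫ m = f ∧ r ≫ m = g := by
      intro T f g
      obtain ⟨m, ⟨h₁, h₂⟩, hu⟩ := hP T f (γ ≫ g.toNatTrans)
      refine ⟨m, ⟨h₁, ?_⟩, ?_⟩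
      · refine (hF T (γ ≫ g.toNatTrans)).unique ?_ rfl
        exact (Category.assoc _ _ _).symm.trans ((congrArg (· ≫ m.toNatTrans) hr).trans h₂)
      · rintro m' ⟨h₁', rfl⟩
        refine hu m' ⟨h₁', ?_⟩
        exact (congrArg (· ≫ m'.toNatTrans) hr).symm.trans (Category.assoc _ _ _)
    exact Limits.BinaryCofan.IsColimit.mk _ (fun {T} f g => (key T f g).choose)
      (fun f g => (key _ f g).choose_spec.1.1) (fun f g => (key _ f g).choose_spec.1.2)
      (fun f g m h₁ h₂ => (key _ f g).choose_spec.2 m ⟨h₁, h₂⟩)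

/-- The bialgebra structure on the sets `T X` induced by a monad morphism from `S` and a natural
transformation from `H` to the monad `T`. -/
def Bialgebra.ofMonad {S : Monad (Type u)} {H : Type u ⥤ Type u} {T : Monad (Type u)} (s : S ⟶ T)
    (t : H ⟶ T.toFunctor) (X : Type u) : Bialgebra S H (T.obj X) where
  act a := bind T (ev s a) fun b => b
  op w := bind T (nev t w) fun b => b
  act_unit x := by rw [ev_unit, unit_bind]
  act_bind X a f := by rw [ev_bind, bind_bind, ev_fmap, bind_fmap]

theorem Bialgebra.isHom_bind {S : Monad (Type u)} {H : Type u ⥤ Type u} {T : Monad (Type u)}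
    (s : S ⟶ T) (t : H ⟶ T.toFunctor) {X Y : Type u} (f : X → T.obj Y) :
    IsHom (ofMonad s t X) (ofMonad s t Y) fun a => bind T a f where
  map_act a := by
    change bind T (bind T (ev s a) _) f = bind T (ev s (fmap S.toFunctor _ a)) _
    rw [bind_bind, ev_fmap, bind_fmap]
  map_op w := by
    change bind T (bind T (nev t w) _) f = bind T (nev t (fmap H _ w)) _
    rw [bind_bind, nev_fmap, bind_fmap]

/-- Free bialgebras on all sets form a monad. -/
theorem exists_monad_of_free {S : Monad (Type u)} {H : Type u ⥤ Type u}
    (h : ∀ X : Type u, ∃ (A : Type u) (α : Bialgebra S H A) (i : X → A), α.IsFree i) :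
    ∃ (P : Monad (Type u)) (α : ∀ X : Type u, Bialgebra S H (P.obj X)),
      (∀ X : Type u, (α X).IsFree fun x : X => unit P x) ∧
      ∀ (X Y : Type u) (f : X → P.obj Y), (α X).IsHom (α Y) fun a => bind P a f := by
  choose A α i hα using h
  choose lift hlift _ using fun X Y : Type u => hα X (A Y) (α Y)
  have hom : ∀ X Y f, (α X).IsHom (α Y) (lift X Y f) := fun X Y f => (hlift X Y f).1
  have lift_i : ∀ X Y f x, lift X Y f (i X x) = f x := fun X Y f => (hlift X Y f).2
  refine ⟨monadOfBind A i lift lift_i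
    (fun X => (hα X).hom_ext (hom X X (i X)) (α X).isHom_id fun x => lift_i X X _ x)
    (fun X Y Z f g => (hα X).hom_ext ((hom Y Z g).comp (hom X Y f)) (hom X Z _) fun x => by
      rw [lift_i, lift_i]), α, hα, fun X Y f => ?_⟩
  exact (funext fun a => bind_monadOfBind a f : (fun a => bind _ a f) = lift X Y f) ▸ hom X Y f

/-- A cocone on `T` turns every `T X` into a bialgebra, and freeness of `P X` gives the components
of the mediating morphism. Both compatibility with `bind` and uniqueness come from comparing
bialgebra homomorphisms on generators. -/
theorem exists_isCopair {S : Monad (Type u)} {H : Type u ⥤ Type u}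
    (h : ∀ X : Type u, ∃ (A : Type u) (α : Bialgebra S H A) (i : X → A), α.IsFree i) :
    ∃ P s t, IsCopair S H P s t := by
  obtain ⟨P, α, hfree, hbind⟩ := exists_monad_of_free h
  let s : S ⟶ P := homOf (fun X a => (α X).act (fmap S.toFunctor (fun x => unit P x) a))
    (fun X x => by rw [fmap_unit, (α X).act_unit])
    (fun X Y a f => by
      rw [(hbind _ _ _).map_act, fmap_fmap, fmap_bind, (α Y).act_bind]
      simp only [unit_bind])
  let t : H ⟶ P.toFunctor := natOf (fun X w => (α X).op (fmap H (fun x => unit P x) w))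
    (fun X Y f w => by
      rw [fmap_eq_bind, (hbind _ _ _).map_op, fmap_fmap, fmap_fmap]
      simp only [unit_bind])
  -- The free structure is recovered from `s` and `t`, because extending the identity of `P X` is a
  -- homomorphism. Hence any mediating morphism preserves it.
  have act_eq : ∀ (X : Type u) (a : S.obj (P.obj X)),
      (α X).act a = bind P (ev s a) fun b => b := fun X a => by
    refine Eq.trans ?_ ((hbind (P.obj X) X _).map_act (fmap S.toFunctor _ a)).symm
    rw [fmap_fmap]
    simp only [unit_bind]
    rw [fmap_id]
  have op_eq : ∀ (X : Type u) (w : H.obj (P.obj X)),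
      (α X).op w = bind P (nev t w) fun b => b := fun X w => by
    refine Eq.trans ?_ ((hbind (P.obj X) X _).map_op (fmap H _ w)).symm
    rw [fmap_fmap]
    simp only [unit_bind]
    rw [fmap_id]
  refine ⟨P, s, t, fun T s' t' => ?_⟩
  choose φ₀ hφ₀ _ using
    fun X : Type u => hfree X (T.obj X) (Bialgebra.ofMonad s' t' X) (fun x => unit T x)
  have φ₀_unit : ∀ (X : Type u) (x : X), φ₀ X (unit P x) = unit T x := fun X => (hφ₀ X).2
  have φ₀_hom : ∀ X, (α X).IsHom (Bialgebra.ofMonad s' t' X) (φ₀ X) := fun X => (hφ₀ X).1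
  let φ : P ⟶ T := homOf φ₀ φ₀_unit (fun X Y a f => (hfree X).hom_ext
    ((φ₀_hom Y).comp (hbind X Y f))
    ((Bialgebra.isHom_bind s' t' fun x => φ₀ Y (f x)).comp (φ₀_hom X))
    (fun x => by rw [φ₀_unit, unit_bind, unit_bind]) a)
  refine ⟨φ, ⟨hom_ext fun X a => ?_, nat_ext fun X w => ?_⟩, ?_⟩
  · change φ₀ X ((α X).act (fmap S.toFunctor _ a)) = _
    rw [(φ₀_hom X).map_act, fmap_fmap]
    simp only [φ₀_unit]
    change bind T (ev s' (fmap S.toFunctor _ a)) _ = _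
    rw [ev_fmap, bind_fmap, bind_unit]
  · change φ₀ X ((α X).op (fmap H _ w)) = _
    rw [(φ₀_hom X).map_op, fmap_fmap]
    simp only [φ₀_unit]
    change bind T (nev t' (fmap H _ w)) _ = _
    rw [nev_fmap, bind_fmap, bind_unit]
  · rintro ψ ⟨rfl, rfl⟩
    refine hom_ext fun X a => (hfree X).hom_ext (g := fun a => ev ψ a)
      ⟨fun a => ?_, fun w => ?_⟩ (φ₀_hom X) (fun x => ?_) a
    · change _ = bind T (ev (s ≫ ψ) (fmap S.toFunctor _ a)) _
      rw [act_eq, ev_bind, ev_fmap, bind_fmap, ev_comp]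
    · change _ = bind T (nev (t ≫ ψ.toNatTrans) (fmap H _ w)) _
      rw [op_eq, ev_bind, nev_fmap, bind_fmap]
      rfl
    · rw [φ₀_unit, ev_unit]

/-- The functor `Z ↦ X + H (S Z)`. -/
def sumCompFunctor (S : Monad (Type u)) (H : Type u ⥤ Type u) (X : Type u) :
    Type u ⥤ Type u where
  obj Z := X ⊕ H.obj (S.obj Z)
  map f := ↾(Sum.map id (fmap H (fmap S.toFunctor f)))
  map_id Z := by
    ext x
    rcases x with x | w
    · rfl
    · change Sum.inr (fmap H (fmap S.toFunctor fun x => x) w) = Sum.inr w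
      rw [show fmap S.toFunctor (fun x : Z => x) = fun a => a from funext (fmap_id _), fmap_id]
  map_comp f g := by
    ext x
    rcases x with x | w
    · rfl
    · change Sum.inr (fmap H (fmap S.toFunctor fun x => g (f x)) w) =
        Sum.inr (fmap H (fmap S.toFunctor g) (fmap H (fmap S.toFunctor f) w))
      simp only [fmap_fmap]

/-- If `Y` is initial for `Z ↦ X + H (S Z)` then `S Y` is a free bialgebra on `X`. -/
theorem exists_free_of_initial {S : Monad (Type u)} {H : Type u ⥤ Type u} {X Y : Type u}
    {y : X ⊕ H.obj (S.obj Y) → Y} (hy : IsInitialAlgebra (sumCompFunctor S H X) Y y) :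
    ∃ (A : Type u) (α : Bialgebra S H A) (i : X → A), α.IsFree i := by
  let α : Bialgebra S H (S.obj Y) :=
    { act := fun a => bind S a fun b => b
      op := fun w => unit S (y (.inr w))
      act_unit := fun x => unit_bind S x _
      act_bind := fun X a f => by rw [bind_bind, bind_fmap] }
  refine ⟨_, α, fun x => unit S (y (.inl x)), fun B β f => ?_⟩
  -- A bialgebra on `B` is read as an algebra of `Z ↦ X + H (S Z)` by first evaluating `S B` in `B`.
  obtain ⟨k, hk, hu⟩ := hy B (Sum.elim f fun w => β.op (fmap H β.act w))
  have hk_inl : ∀ x, k (y (.inl x)) = f x := fun x => hk (.inl x)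
  have hk_inr : ∀ w, k (y (.inr w)) = β.op (fmap H β.act (fmap H (fmap S.toFunctor k) w)) :=
    fun w => hk (.inr w)
  refine ⟨fun a => β.act (fmap S.toFunctor k a), ⟨⟨fun a => ?_, fun w => ?_⟩, fun x => ?_⟩, ?_⟩
  · change β.act (fmap S.toFunctor k (bind S a _)) = _
    rw [fmap_bind, β.act_bind]
  · change β.act (fmap S.toFunctor k (unit S _)) = _
    rw [fmap_unit, β.act_unit, hk_inr, fmap_fmap]
  · change β.act (fmap S.toFunctor k (unit S _)) = _
    rw [fmap_unit, β.act_unit, hk_inl]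
  · rintro g ⟨hg, hgi⟩
    -- A homomorphism out of the free `S`-algebra `S Y` is determined by its restriction to `Y`.
    have hg' : ∀ a : S.obj Y, g a = β.act (fmap S.toFunctor (fun z => g (unit S z)) a) := by
      intro a
      have := hg.map_act (fmap S.toFunctor (fun z => unit S z) a)
      rw [fmap_fmap] at this
      refine Eq.trans ?_ this
      change g a = g (bind S _ _)
      rw [bind_fmap, bind_unit]
    have : (fun z => g (unit S z)) = k := by
      refine hu _ ?_
      rintro (x | w)
      · exact hgi x
      · refine (hg.map_op w).trans ?_
        change _ = β.op (fmap H β.act (fmap H (fmap S.toFunctor _) w))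
        rw [fmap_fmap]
        congr 2
        funext a
        exact hg' a
    funext a
    rw [hg' a, this]

/-- Absorption for infinite `Z` gives an injection `X + H (S Z) → Z`, that is, an algebra with
injective structure map. -/
theorem exists_isCopair_of_card_le {S : Monad (Type u)} {H : Type u ⥤ Type u}
    (h : ∀ X : Type u, ∃ Z : Type u, Infinite Z ∧ Cardinal.mk X ≤ Cardinal.mk Z ∧
      Cardinal.mk (H.obj (S.obj Z)) ≤ Cardinal.mk Z) : ∃ P s t, IsCopair S H P s t := by
  refine exists_isCopair fun X => ?_
  obtain ⟨Z, hZ, h₁, h₂⟩ := h X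
  have : Cardinal.mk (X ⊕ H.obj (S.obj Z)) ≤ Cardinal.mk Z := by
    rw [Cardinal.mk_sum, Cardinal.lift_id, Cardinal.lift_id]
    exact Cardinal.add_le_of_le (Cardinal.aleph0_le_mk Z) h₁ h₂
  obtain ⟨a⟩ := this
  obtain ⟨Y, y, hy⟩ := exists_isInitialAlgebra (sumCompFunctor S H X) a a.injective
  exact exists_free_of_initial hy

/-! ### The coproduct formula -/

/-- The comparison map from `S (X + H (P X))` to `P X`. -/
def copairEval {S P : Monad (Type u)} {H : Type u ⥤ Type u} (s : S ⟶ P) (t : H ⟶ P.toFunctor)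
    (X : Type u) (a : S.obj (X ⊕ H.obj (P.obj X))) : P.obj X :=
  bind P (ev s a) (Sum.elim (fun x => unit P x) fun w => bind P (nev t w) fun p => p)

/-- Kleisli extension for the monad `X ↦ S (X + H (P X))`. -/
def copairExt {S P : Monad (Type u)} {H : Type u ⥤ Type u} (s : S ⟶ P) (t : H ⟶ P.toFunctor)
    (X Y : Type u) (f : X → S.obj (Y ⊕ H.obj (P.obj Y))) (a : S.obj (X ⊕ H.obj (P.obj X))) :
    S.obj (Y ⊕ H.obj (P.obj Y)) :=
  bind S a (Sum.elim f fun w =>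
    unit S (.inr (fmap H (fun p => bind P p fun x => copairEval s t Y (f x)) w)))

theorem copairEval_unit_inl {S P : Monad (Type u)} {H : Type u ⥤ Type u} (s : S ⟶ P)
    (t : H ⟶ P.toFunctor) {X : Type u} (x : X) :
    copairEval s t X (unit S (.inl x)) = unit P x := by
  rw [copairEval, ev_unit, unit_bind]
  rfl

/-- This makes evaluation a monad morphism, and is already needed for associativity of `copairExt`.
-/
theorem copairEval_ext {S P : Monad (Type u)} {H : Type u ⥤ Type u} (s : S ⟶ P)
    (t : H ⟶ P.toFunctor) {X Y : Type u} (f : X → S.obj (Y ⊕ H.obj (P.obj Y)))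
    (a : S.obj (X ⊕ H.obj (P.obj X))) :
    copairEval s t Y (copairExt s t X Y f a) =
      bind P (copairEval s t X a) fun x => copairEval s t Y (f x) := by
  rw [copairExt, copairEval, ev_bind, bind_bind, copairEval, bind_bind]
  congr 1
  funext z
  rcases z with x | w
  · simp only [Sum.elim_inl, unit_bind]
    rfl
  · simp only [Sum.elim_inr, ev_unit, unit_bind, nev_fmap, bind_fmap, bind_bind]

/-- The monad `X ↦ S (X + H (P X))`. -/
theorem exists_copairMonad {S P : Monad (Type u)} {H : Type u ⥤ Type u} (s : S ⟶ P)
    (t : H ⟶ P.toFunctor) :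
    ∃ (T : Monad (Type u)) (e : ∀ X : Type u, T.obj X ≃ S.obj (X ⊕ H.obj (P.obj X))),
      (∀ (X : Type u) (x : X), e X (unit T x) = unit S (.inl x)) ∧
      ∀ (X Y : Type u) (a : T.obj X) (f : X → T.obj Y),
        e Y (bind T a f) = copairExt s t X Y (fun x => e Y (f x)) (e X a) := by
  refine ⟨monadOfBind (fun X => S.obj (X ⊕ H.obj (P.obj X))) (fun X x => unit S (.inl x))
    (copairExt s t) (fun X Y f x => ?_) (fun X a => ?_) (fun X Y Z f g a => ?_),
    fun X => Equiv.refl _, fun X x => rfl,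
    fun X Y a f => bind_monadOfBind (M := fun X => S.obj (X ⊕ H.obj (P.obj X)))
      (ext := copairExt s t) a f⟩
  · rw [copairExt, unit_bind]
    rfl
  · rw [copairExt]
    refine Eq.trans ?_ (bind_unit S a)
    congr 1
    funext z
    rcases z with x | w
    · rfl
    · simp only [copairEval_unit_inl, bind_unit, fmap_id, Sum.elim_inr]
  · simp only [copairExt, bind_bind]
    congr 1
    funext z
    rcases z with x | w
    · rfl
    · simp only [Sum.elim_inr, unit_bind, fmap_fmap, bind_bind]
      simp only [← copairEval_ext]
      rfl

/-- If the coproduct `P` of `S` with the free monad on `H` exists then `P X ≅ S (X + H (P X))`. -/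
theorem IsCopair.bijective_eval {S P : Monad (Type u)} {H : Type u ⥤ Type u} {s : S ⟶ P}
    {t : H ⟶ P.toFunctor} (hP : IsCopair S H P s t) (X : Type u) :
    Function.Bijective (copairEval s t X) := by
  -- A Lambek-style argument: `T X = S (X + H (P X))` is itself a cocone, so there is `m : P ⟶ T`,
  -- and evaluation `ε` is shown to be its inverse.
  obtain ⟨T, e, e_unit, e_bind⟩ := exists_copairMonad s t
  let ε : T ⟶ P := homOf (fun X a => copairEval s t X (e X a))
    (fun X x => by rw [e_unit, copairEval_unit_inl])
    (fun X Y a f => by rw [e_bind, copairEval_ext])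
  have ev_ε : ∀ (X : Type u) (a : T.obj X), ev ε a = copairEval s t X (e X a) := fun X a => rfl
  let s' : S ⟶ T := homOf (fun X a => (e X).symm (fmap S.toFunctor (fun x => .inl x) a))
    (fun X x => by rw [Equiv.symm_apply_eq, fmap_unit, e_unit])
    (fun X Y a f => by
      rw [Equiv.symm_apply_eq, e_bind, copairExt]
      simp only [Equiv.apply_symm_apply, bind_fmap, fmap_bind, Sum.elim_inl])
  have e_s' : ∀ (X : Type u) (a : S.obj X),
      e X (ev s' a) = fmap S.toFunctor (fun x => .inl x) a := fun X a => (e X).apply_symm_apply _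
  let t' : H ⟶ T.toFunctor := natOf
    (fun X w => (e X).symm (unit S (.inr (fmap H (fun x => unit P x) w))))
    (fun X Y f w => by
      rw [Equiv.symm_apply_eq, fmap_eq_bind, e_bind, copairExt, Equiv.apply_symm_apply, unit_bind]
      simp only [Sum.elim_inr, fmap_fmap, e_unit, copairEval_unit_inl, unit_bind])
  have e_t' : ∀ (X : Type u) (w : H.obj X),
      e X (nev t' w) = unit S (.inr (fmap H (fun x => unit P x) w)) :=
    fun X a => (e X).apply_symm_apply _
  obtain ⟨m, ⟨hm_s, hm_t⟩, -⟩ := hP T s' t'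
  have m_s : ∀ (X : Type u) (a : S.obj X), ev m (ev s a) = ev s' a := fun X a => by
    rw [← hm_s, ev_comp]
  have m_t : ∀ (X : Type u) (w : H.obj X), ev m (nev t w) = nev t' w := fun X a => by
    rw [← hm_t]
    rfl
  have hid : m ≫ ε = 𝟙 P := by
    refine (hP P s t).unique ⟨hom_ext fun X a => ?_, nat_ext fun X w => ?_⟩
      ⟨Category.comp_id _, rfl⟩
    · rw [ev_comp, ev_comp, m_s, ev_ε, e_s', copairEval, ev_fmap, bind_fmap]
      exact bind_unit P _
    · change ev ε (ev m (nev t w)) = _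
      rw [m_t, ev_ε, e_t', copairEval, ev_unit, unit_bind, Sum.elim_inr, nev_fmap, bind_fmap,
        bind_unit]
  have hid' : ∀ (X : Type u) (p : P.obj X), ev ε (ev m p) = p := fun X p =>
    congrArg (fun f : P ⟶ P => ev f p) hid
  -- On the summand `H (P X)` the composite acts by `H` applied to `m` followed by `ε`, already
  -- known to be the identity.
  have left : ∀ a : S.obj (X ⊕ H.obj (P.obj X)), e X (ev m (copairEval s t X a)) = a := by
    intro a
    rw [copairEval, ev_bind, m_s, e_bind, e_s', copairExt, bind_fmap]
    refine Eq.trans ?_ (bind_unit S a)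
    congr 1
    funext z
    rcases z with x | w
    · rw [Sum.elim_inl, Sum.elim_inl, ev_unit, e_unit]
    · rw [Sum.elim_inl, Sum.elim_inr, ev_bind, m_t, e_bind, e_t', copairExt, unit_bind,
        Sum.elim_inr, fmap_fmap]
      simp only [unit_bind, ← ev_ε, hid', fmap_id]
  exact ⟨Function.LeftInverse.injective (g := fun p => e X (ev m p)) left, fun p => ⟨e X (ev m p), hid' X p⟩⟩

/-- A free monad on `H` is the coproduct of the identity monad with itself. -/
theorem IsFreeMonad.isCopair {H : Type u ⥤ Type u} {F : Monad (Type u)} {γ : H ⟶ F.toFunctor}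
    (hF : IsFreeMonad H F γ) :
    ∃ s : Monad.id (Type u) ⟶ F, IsCopair (Monad.id (Type u)) H F s γ := by
  let i : ∀ T : Monad (Type u), Monad.id (Type u) ⟶ T := fun T =>
    homOf (fun X x => unit T (show X from x)) (fun X x => rfl)
      (fun X Y x f => (unit_bind T (show X from x) fun x => unit T (f x : Y)).symm)
  have huniq : ∀ (T : Monad (Type u)) (f : Monad.id (Type u) ⟶ T), f = i T := fun T f =>
    hom_ext fun X x => ev_unit f (show X from x)
  refine ⟨i F, fun T s' t' => ?_⟩
  obtain ⟨φ, hφ, hu⟩ := hF T t'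
  exact ⟨φ, ⟨(huniq T _).trans (huniq T _).symm, hφ⟩, fun ψ hψ => hu ψ hψ.2⟩

/-- This is the coproduct formula `P X ≅ S (X + H (P X))` with `S` the identity monad. -/
theorem IsFreeMonad.bijective {H : Type u ⥤ Type u} {F : Monad (Type u)} {γ : H ⟶ F.toFunctor}
    (hF : IsFreeMonad H F γ) (X : Type u) :
    Function.Bijective (Sum.elim (fun x => unit F x) fun w => bind F (nev γ w) fun p => p :
      X ⊕ H.obj (F.obj X) → F.obj X) := by
  obtain ⟨s, hs⟩ := hF.isCopair
  have h : ∀ z : X ⊕ H.obj (F.obj X), copairEval s γ X z =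
      Sum.elim (fun x => unit F x) (fun w => bind F (nev γ w) fun p => p) z := fun z => by
    have hs : ev s (S := Monad.id (Type u)) (X := X ⊕ H.obj (F.obj X)) z = unit F z := ev_unit s z
    exact (congrArg (fun p => bind F p _) hs).trans (unit_bind F z _)
  exact (funext h : copairEval s γ X = _) ▸ hs.bijective_eval X

/-! ### Cardinalities of values of set functors -/

/-- An injection with nonempty domain splits, and functors preserve split injections; for empty
domain this can fail. -/
theorem mk_obj_le (H : Type u ⥤ Type u) {Y Z : Type u} [Nonempty Y]
    (h : Cardinal.mk Y ≤ Cardinal.mk Z) : Cardinal.mk (H.obj Y) ≤ Cardinal.mk (H.obj Z) := by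
  obtain ⟨f⟩ := h
  refine ⟨⟨fmap H f, Function.LeftInverse.injective (g := fmap H (Function.invFun f)) fun a => ?_⟩⟩
  rw [fmap_fmap]
  simp only [Function.leftInverse_invFun f.injective _, fmap_id]

theorem mk_obj_congr (H : Type u ⥤ Type u) {Y Z : Type u} [Nonempty Y]
    (h : Cardinal.mk Y = Cardinal.mk Z) : Cardinal.mk (H.obj Y) = Cardinal.mk (H.obj Z) := by
  have : Nonempty Z := by rwa [← Cardinal.mk_ne_zero_iff, ← h, Cardinal.mk_ne_zero_iff]
  exact le_antisymm (mk_obj_le H h.le) (mk_obj_le H h.ge)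

/-- A set functor that is not constant on nonempty sets does not decrease large cardinals. -/
theorem le_mk_obj (H : Type u ⥤ Type u) {X : Type u} (p : X)
    (h : ¬ Function.Surjective (fmap H fun _ : PUnit => p)) {Z : Type u} [Infinite Z]
    (hZ : Cardinal.mk X ≤ Cardinal.mk Z) : Cardinal.mk Z ≤ Cardinal.mk (H.obj Z) := by
  classical
  simp only [Function.Surjective, not_forall, not_exists] at h
  obtain ⟨t, ht⟩ := h
  -- Place `t` in the copy `{z} × X`. Collapsing all other copies to `p` recovers `t` from this
  -- copy, but sends any other copy of `t` into the image of the constant map.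
  have hinj : Function.Injective fun z : Z => fmap H (fun x => (z, x)) t := by
    intro z z' hz
    by_contra hne
    have := congrArg (fmap H fun q : Z × X => if q.1 = z then q.2 else p) hz
    simp only [fmap_fmap, if_true, if_neg (Ne.symm hne), fmap_id] at this
    refine ht (fmap H (fun _ => PUnit.unit) t) ?_
    rw [fmap_fmap, ← this]
  have : Nonempty X := ⟨p⟩
  refine (Cardinal.mk_le_of_injective hinj).trans (mk_obj_le H ?_)
  rw [Cardinal.mk_prod, Cardinal.lift_id, Cardinal.lift_id]
  exact Cardinal.mul_le_of_le (Cardinal.aleph0_le_mk Z) le_rfl hZ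

theorem IsFreeMonad.mk_obj_obj_le {H : Type u ⥤ Type u} {F : Monad (Type u)}
    {γ : H ⟶ F.toFunctor} (hF : IsFreeMonad H F γ) (X : Type u) :
    Cardinal.mk (H.obj (F.obj X)) ≤ Cardinal.mk (F.obj X) :=
  Cardinal.mk_le_of_injective ((hF.bijective X).1.comp Sum.inr_injective)

theorem IsFreeMonad.mk_le_mk_obj {H : Type u ⥤ Type u} {F : Monad (Type u)}
    {γ : H ⟶ F.toFunctor} (hF : IsFreeMonad H F γ) (X : Type u) :
    Cardinal.mk X ≤ Cardinal.mk (F.obj X) :=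
  Cardinal.mk_le_of_injective ((hF.bijective X).1.comp Sum.inl_injective)

/-- Every element of a value of a finitary functor is supported by a finite subset. -/
theorem exists_finset_of_preservesFilteredColimits (S : Type u ⥤ Type u)
    (hS : Limits.PreservesFilteredColimits S) {X : Type u} (a : S.obj X) :
    ∃ (s : Finset X) (b : S.obj s), fmap S Subtype.val b = a := by
  classical
  let D : Finset X ⥤ Type u :=
    { obj := fun s => s
      map := fun {s s'} f => ↾fun x => ⟨x.1, leOfHom f x.2⟩ }
  let c : Limits.Cocone D :=
    { pt := X
      ι := { app := fun s => ↾fun x => x.1 } }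
  have hc : Limits.IsColimit c := Limits.Types.FilteredColimit.isColimitOf D c
    (fun x => ⟨{x}, ⟨x, Finset.mem_singleton_self x⟩, rfl⟩)
    (fun i j xi xj h => ⟨i ∪ j, homOfLE Finset.subset_union_left,
      homOfLE Finset.subset_union_right, Subtype.ext h⟩)
  have := hS.preserves_filtered_colimits (Finset X)
  exact Limits.Types.jointly_surjective_of_isColimit (Limits.isColimitOfPreserves S hc) a

/-- An element is encoded by a finite support together with an element of `S` on a finite ordinal;
an infinite `X` has only `card X` finite subsets. -/
theorem mk_obj_le_of_preservesFilteredColimits (S : Type u ⥤ Type u)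
    (hS : Limits.PreservesFilteredColimits S) {X : Type u} [Infinite X]
    (hX : Cardinal.mk (Σ n : ULift.{u} ℕ, S.obj (ULift.{u} (Fin n.down))) ≤ Cardinal.mk X) :
    Cardinal.mk (S.obj X) ≤ Cardinal.mk X := by
  choose s b hb using fun a : S.obj X => exists_finset_of_preservesFilteredColimits S hS a
  let e : ∀ s : Finset X, s ≃ ULift.{u} (Fin s.card) :=
    fun s => s.equivFin.trans Equiv.ulift.symm
  let g : (Σ s : Finset X, S.obj s) → Finset X × Σ n : ULift.{u} ℕ, S.obj (ULift.{u} (Fin n.down)) :=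
    fun q => (q.1, ⟨⟨q.1.card⟩, fmap S (e q.1) q.2⟩)
  have hg : Function.Injective g := by
    rintro ⟨s, b⟩ ⟨s', b'⟩ h
    obtain rfl : s = s' := congrArg Prod.fst h
    have h₂ : fmap S (e s) b = fmap S (e s) b' := eq_of_heq (Sigma.mk.inj (congrArg Prod.snd h)).2
    have := congrArg (fmap S (e s).symm) h₂
    simp only [fmap_fmap, Equiv.symm_apply_apply, fmap_id] at this
    rw [this]
  have hsb : Function.Injective fun a => (⟨s a, b a⟩ : Σ s : Finset X, S.obj s) := by
    exact Function.LeftInverse.injective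
      (g := fun q : Σ s : Finset X, S.obj s => fmap S Subtype.val q.2) hb
  refine (Cardinal.mk_le_of_injective (hg.comp hsb)).trans ?_
  rw [Cardinal.mk_prod, Cardinal.lift_id, Cardinal.lift_id, Cardinal.mk_finset_of_infinite]
  exact Cardinal.mul_le_of_le (Cardinal.aleph0_le_mk X) le_rfl hX

/-! ### Substantially exceptional monads -/

/-- A monad is substantially exceptional if it has a morphism to an exception monad that is
bijective on nonempty sets. -/
theorem SubstantiallyExceptional.of_hom {F : Monad (Type u)} {E : Type u}
    (φ : F ⟶ exceptionMonad E)
    (hφ : ∀ (X : Type u) [Nonempty X], Function.Bijective (ev φ : F.obj X → _)) :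
    SubstantiallyExceptional F := by
  have ev_fmap' : ∀ {X Y : Type u} (f : X → Y) (a : F.obj X),
      (ev φ (fmap F.toFunctor f a) : Y ⊕ E) = Sum.map f id (ev φ a : X ⊕ E) :=
    fun f a => ev_fmap φ f a
  choose r hr using fun (X : Type u) (z : Option X ⊕ E) => (hφ (Option X)).2 z
  -- Elements of the closure live over `Option X`, which is nonempty even for empty `X`, so `φ` can
  -- be inverted there.
  let ψ₀ : ∀ X : Type u, X ⊕ E → TrnkovaObj F.toFunctor X := fun X z =>
    ⟨r X (Sum.map some id z), by
      refine (hφ _).1 ?_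
      rw [ev_fmap', ev_fmap', hr]
      cases z <;> rfl⟩
  have ev_ψ₀ : ∀ (X : Type u) (z : X ⊕ E), ev φ (ψ₀ X z).val = Sum.map some id z :=
    fun X z => hr X _
  have ext_val : ∀ {X : Type u} {a b : TrnkovaObj F.toFunctor X},
      ev φ a.val = ev φ b.val → a = b := fun h => TrnkovaObj.ext ((hφ _).1 h)
  have bind_val : ∀ {X Y : Type u} (a : TrnkovaObj F.toFunctor X)
      (f : X → TrnkovaObj F.toFunctor Y), TrnkovaObj.val (bind (trnkovaMonad F) a f) =
        bind F a.val fun o => trnkovaSubst F Y (Option.map f o) :=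
    fun a f => bind_fmap F _ _ a.val
  let ψ : exceptionMonad E ⟶ trnkovaMonad F := homOf ψ₀
    (fun X x => ext_val ((ev_ψ₀ X (.inl x)).trans
      ((ev_fmap φ some (unit F x)).trans (by rw [ev_unit, fmap_unit]; rfl)).symm))
    (fun X Y a f => by
      refine ext_val ((ev_ψ₀ Y _).trans ?_)
      rw [bind_val, ev_bind]
      refine Eq.trans ?_ (congrArg (fun c => bind (exceptionMonad E) c _) (ev_ψ₀ X a)).symm
      rcases a with x | e
      · exact (ev_ψ₀ Y (f x)).symm
      · rfl)
  have hψ : ∀ X : Type u, Function.Bijective (ψ₀ X) := by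
    refine fun X => ⟨fun z z' h => ?_, fun a => ?_⟩
    · have h₁ := congrArg (fun a => ev φ (TrnkovaObj.val a)) h
      simp only [ev_ψ₀] at h₁
      exact Sum.map_injective.2 ⟨Option.some_injective X, Function.injective_id⟩ h₁
    · have h := congrArg (ev φ) a.property
      rw [ev_fmap', ev_fmap'] at h
      -- The equalizer condition excludes the added point `none`, which the two maps send to `none`
      -- and `some none`.
      suffices ∃ z, Sum.map some id z = ev φ a.val by
        obtain ⟨z, hz⟩ := this
        exact ⟨z, ext_val ((ev_ψ₀ X z).trans hz)⟩
      generalize (ev φ a.val : Option X ⊕ E) = c at h ⊢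
      rcases c with (_ | x) | e
      · cases h
      · exact ⟨.inl x, rfl⟩
      · exact ⟨.inr e, rfl⟩
  let i : (exceptionMonad E : Type u ⥤ Type u) ≅ trnkovaMonad F :=
    NatIso.ofComponents (fun X => (Equiv.ofBijective _ (hψ X)).toIso)
      (fun f => ψ.toNatTrans.naturality f)
  exact ⟨E, ⟨(MonadIso.mk i ψ.app_η ψ.app_μ).symm⟩⟩

theorem SubstantiallyExceptional.exists_hom {S : Monad (Type u)}
    (hS : SubstantiallyExceptional S) :
    ∃ (E : Type u) (φ : S ⟶ exceptionMonad E),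
      ∀ (X : Type u) [Nonempty X], Function.Bijective (ev φ : S.obj X → _) := by
  obtain ⟨E, ⟨i⟩⟩ := hS
  refine ⟨E, trnkovaUnitHom S ≫ i.hom, fun X _ => ?_⟩
  have hi : Function.Bijective (ev i.hom : (trnkovaMonad S).obj X → _) := by
    refine Function.bijective_iff_has_inverse.2 ⟨ev i.inv, fun a => ?_, fun a => ?_⟩
    · rw [← ev_comp, i.hom_inv_id, ev_id]
    · rw [← ev_comp, i.inv_hom_id, ev_id]
  exact hi.comp (trnkovaUnit_bijective S.toFunctor X)

theorem SubstantiallyExceptional.exists_mk_obj_le {S : Monad (Type u)}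
    (hS : SubstantiallyExceptional S) :
    ∃ κ : Cardinal.{u}, ∀ (Z : Type u) [Infinite Z], κ ≤ Cardinal.mk Z →
      Cardinal.mk (S.obj Z) ≤ Cardinal.mk Z := by
  obtain ⟨E, φ, hφ⟩ := hS.exists_hom
  refine ⟨Cardinal.mk E, fun Z _ hZ => (Cardinal.mk_le_of_injective (hφ Z).1).trans ?_⟩
  change Cardinal.mk (Z ⊕ E) ≤ _
  rw [Cardinal.mk_sum, Cardinal.lift_id, Cardinal.lift_id]
  exact Cardinal.add_le_of_le (Cardinal.aleph0_le_mk Z) le_rfl hZ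

/-- If the free monad on `H` is substantially exceptional, then the values of `H` on nonempty sets
are bounded. -/
theorem IsFreeMonad.exists_mk_obj_le {H : Type u ⥤ Type u} {F : Monad (Type u)}
    {γ : H ⟶ F.toFunctor} (hF : IsFreeMonad H F γ) (h : SubstantiallyExceptional F) :
    ∃ κ : Cardinal.{u}, ∀ (X : Type u) [Nonempty X], Cardinal.mk (H.obj X) ≤ κ := by
  obtain ⟨E, φ, hφ⟩ := h.exists_hom
  refine ⟨Cardinal.mk E, fun X _ => (mk_obj_le H (hF.mk_le_mk_obj X)).trans ?_⟩
  have hinj := (hφ X).1.comp (hF.bijective X).1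
  -- The summand `X` of `X ⊕ E` is already hit by units, so injectivity forces `H (F X)` into `E`.
  have hr : ∀ w : H.obj (F.obj X), ∃ e : E,
      (ev φ (bind F (nev γ w) fun p => p) : X ⊕ E) = .inr e := by
    intro w
    rcases hx : (ev φ (bind F (nev γ w) fun p => p) : X ⊕ E) with x | e
    · have : (Sum.inr w : X ⊕ H.obj (F.obj X)) = .inl x :=
        hinj (hx.trans (ev_unit φ x).symm)
      cases this
    · exact ⟨e, rfl⟩
  choose e he using hr
  refine Cardinal.mk_le_of_injective (f := e) fun w w' hw => Sum.inr_injective (hinj ?_)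
  exact (he w).trans ((congrArg Sum.inr hw).trans (he w').symm)

/-- The free monad on a functor that is constant on nonempty sets is substantially exceptional. -/
theorem IsFreeMonad.substantiallyExceptional {H : Type u ⥤ Type u} {F : Monad (Type u)}
    {γ : H ⟶ F.toFunctor} (hF : IsFreeMonad H F γ)
    (h : ∀ (X : Type u) (p : X), Function.Surjective (fmap H fun _ : PUnit => p)) :
    SubstantiallyExceptional F := by
  have hbij : ∀ (X : Type u) [Nonempty X],
      Function.Bijective (fmap H fun _ : X => PUnit.unit.{u + 1}) := by
    intro X hX
    obtain ⟨p⟩ := hX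
    refine ⟨fun t t' e => ?_, fun c => ⟨fmap H (fun _ => p) c, ?_⟩⟩
    · obtain ⟨c, rfl⟩ := h X p t
      obtain ⟨c', rfl⟩ := h X p t'
      rw [fmap_fmap, fmap_fmap] at e
      exact congrArg _ ((fmap_id H c).symm.trans (e.trans (fmap_id H c')))
    · rw [fmap_fmap]
      exact fmap_id H c
  let t : H ⟶ (exceptionMonad (H.obj PUnit)).toFunctor :=
    natOf (fun X w => (.inr (fmap H (fun _ => PUnit.unit) w) : X ⊕ H.obj PUnit))
      (fun X Y f w => by rw [fmap_fmap]; rfl)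
  obtain ⟨φ, hφ, -⟩ := hF _ t
  refine SubstantiallyExceptional.of_hom φ fun X _ => ?_
  refine (Function.Bijective.of_comp_iff _ (hF.bijective X)).1 ?_
  -- Under `F X ≅ X + H (F X)`, the morphism `φ` becomes the identity plus the bijection `H (F X) →
  -- H 1`.
  have : (ev φ : F.obj X → _) ∘ (Sum.elim (fun x => unit F x) fun w => bind F (nev γ w) fun p => p) =
      Sum.map id (fmap H fun _ : F.obj X => PUnit.unit) := by
    funext z
    rcases z with x | w
    · exact ev_unit φ x
    · refine (ev_bind φ _ _).trans ?_
      rw [show ev φ (nev γ w) = nev t w from congrArg (fun t => nev t w) hφ]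
      rfl
  rw [this]
  have : Nonempty (F.obj X) := ⟨unit F (Classical.arbitrary X)⟩
  exact Sum.map_bijective.2 ⟨Function.bijective_id, hbij _⟩

/-! ### Existence of coproducts -/

/-- Take `Z = F Y` with `Y` large: then `card H (S Z) ≤ card H Z ≤ card Z`, the last step because `H
(F Y)` embeds in `F Y`. -/
theorem exists_isCopair_of_eventually_le {S : Monad (Type u)} {H : Type u ⥤ Type u}
    {F : Monad (Type u)} {γ : H ⟶ F.toFunctor} (hF : IsFreeMonad H F γ)
    (h : ∃ κ : Cardinal.{u}, ∀ (Z : Type u) [Infinite Z], κ ≤ Cardinal.mk Z →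
      Cardinal.mk (S.obj Z) ≤ Cardinal.mk Z) : ∃ P s t, IsCopair S H P s t := by
  obtain ⟨κ, hκ⟩ := h
  refine exists_isCopair_of_card_le fun X => ?_
  -- The summands make `Y` at least as large as `X` and `κ`, and infinite.
  let Y : Type u := X ⊕ κ.out ⊕ ULift.{u} ℕ
  have hY := hF.mk_le_mk_obj Y
  have : Infinite (F.obj Y) := Cardinal.infinite_iff.2 ((Cardinal.aleph0_le_mk Y).trans hY)
  have : Nonempty (S.obj (F.obj Y)) := ⟨unit S (Classical.arbitrary (F.obj Y))⟩
  refine ⟨F.obj Y, inferInstance, (Cardinal.mk_le_of_injective Sum.inl_injective).trans hY,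
    (mk_obj_le H (hκ _ (le_trans ?_ hY))).trans (hF.mk_obj_obj_le Y)⟩
  conv_lhs => rw [← Cardinal.mk_out κ]
  exact Cardinal.mk_le_of_injective (Sum.inr_injective.comp Sum.inl_injective)

theorem exists_isCopair_of_bounded (S : Monad (Type u)) {H : Type u ⥤ Type u}
    (h : ∃ κ : Cardinal.{u}, ∀ (X : Type u) [Nonempty X], Cardinal.mk (H.obj X) ≤ κ) :
    ∃ P s t, IsCopair S H P s t := by
  obtain ⟨κ, hκ⟩ := h
  refine exists_isCopair_of_card_le fun X => ?_
  let Z : Type u := X ⊕ κ.out ⊕ ULift.{u} ℕ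
  have : Nonempty (S.obj Z) := ⟨unit S (Classical.arbitrary Z)⟩
  refine ⟨Z, inferInstance, Cardinal.mk_le_of_injective Sum.inl_injective, (hκ _).trans ?_⟩
  conv_lhs => rw [← Cardinal.mk_out κ]
  exact Cardinal.mk_le_of_injective (Sum.inr_injective.comp Sum.inl_injective)

theorem exists_isCopair_of_fixpoints {S : Monad (Type u)} {H : Type u ⥤ Type u}
    (h : HaveArbitrarilyLargeJointFixpoints S.toFunctor H) : ∃ P s t, IsCopair S H P s t := by
  refine exists_isCopair_of_card_le fun X => ?_
  obtain ⟨c, hc, hS, hH⟩ := h (max Cardinal.aleph0 (Cardinal.mk X))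
  have : Infinite c.out := by
    rw [Cardinal.infinite_iff, Cardinal.mk_out]
    exact (le_max_left _ _).trans hc
  have : Nonempty (S.obj c.out) := ⟨unit S (Classical.arbitrary c.out)⟩
  refine ⟨c.out, inferInstance, ?_, ?_⟩
  · rw [Cardinal.mk_out]
    exact (le_max_right _ _).trans hc
  · rw [mk_obj_congr H (Eq.trans hS (Cardinal.mk_out c).symm), Cardinal.mk_out]
    exact hH.le

/-- With `Y = X + H (P X)` and `S Y ≅ P X`, consistency gives `card Y ≤ card P X`, while `card P X ≤
card H (P X) ≤ card Y` as `H` is not constant. So all agree, and `card P X` is fixed by `S` and `H`.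
-/
theorem IsCopair.fixpoints {S P : Monad (Type u)} {H : Type u ⥤ Type u} {s : S ⟶ P}
    {t : H ⟶ P.toFunctor} (hP : IsCopair S H P s t) (hS : Consistent S) {X₀ : Type u} (p : X₀)
    (hp : ¬ Function.Surjective (fmap H fun _ : PUnit => p)) :
    HaveArbitrarilyLargeJointFixpoints S.toFunctor H := by
  intro b
  -- `b` makes the fixpoint large, while `X₀` and `ℕ` supply the size and infiniteness required by
  -- `le_mk_obj`.
  let X : Type u := b.out ⊕ X₀ ⊕ ULift.{u} ℕ
  let Y : Type u := X ⊕ H.obj (P.obj X)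
  have hSY : Cardinal.mk (S.obj Y) = Cardinal.mk (P.obj X) :=
    Cardinal.mk_congr (Equiv.ofBijective _ (hP.bijective_eval X))
  have hYP : Cardinal.mk Y ≤ Cardinal.mk (P.obj X) :=
    (Cardinal.mk_le_of_injective (hS Y)).trans hSY.le
  have hXP : Cardinal.mk X ≤ Cardinal.mk (P.obj X) :=
    (Cardinal.mk_le_of_injective Sum.inl_injective).trans hYP
  have : Infinite (P.obj X) := Cardinal.infinite_iff.2 ((Cardinal.aleph0_le_mk X).trans hXP)
  have hPH : Cardinal.mk (P.obj X) ≤ Cardinal.mk (H.obj (P.obj X)) :=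
    le_mk_obj H p hp
      ((Cardinal.mk_le_of_injective (Sum.inr_injective.comp Sum.inl_injective)).trans hXP)
  have hHY : Cardinal.mk (H.obj (P.obj X)) ≤ Cardinal.mk Y :=
    Cardinal.mk_le_of_injective Sum.inr_injective
  have out : Cardinal.mk (P.obj X) = Cardinal.mk (Cardinal.mk (P.obj X)).out :=
    (Cardinal.mk_out _).symm
  refine ⟨Cardinal.mk (P.obj X), ?_, ?_, ?_⟩
  · refine le_trans ?_ hXP
    conv_lhs => rw [← Cardinal.mk_out b]
    exact Cardinal.mk_le_of_injective Sum.inl_injective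
  · refine (mk_obj_congr _ out).symm.trans (Eq.trans ?_ hSY)
    exact mk_obj_congr _ (le_antisymm (hPH.trans hHY) hYP)
  · exact (mk_obj_congr _ out).symm.trans (le_antisymm (hHY.trans hYP) hPH)

end MonadCoproduct

theorem mainTheorem11 :
    (∀ (S : CategoryTheory.Monad (Type u)) (H : Type u ⥤ Type u)
      (F : CategoryTheory.Monad (Type u)) (γ : H ⟶ F.toFunctor),
      MonadCoproduct.Consistent S →
      MonadCoproduct.IsFreeMonad H F γ →
      (Limits.HasBinaryCoproduct S F ↔
        MonadCoproduct.HaveArbitrarilyLargeJointFixpoints S.toFunctor H ∨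
          MonadCoproduct.SubstantiallyExceptional S ∨
          MonadCoproduct.SubstantiallyExceptional F)) ∧
    (∀ (S : CategoryTheory.Monad (Type u)),
      Limits.PreservesFilteredColimits S.toFunctor →
      ∀ (H : Type u ⥤ Type u) (F : CategoryTheory.Monad (Type u))
        (γ : H ⟶ F.toFunctor),
        MonadCoproduct.IsFreeMonad H F γ →
        Limits.HasBinaryCoproduct S F) := by
  refine ⟨fun S H F γ hS hF => ?_, fun S hS H F γ hF => ?_⟩
  · rw [MonadCoproduct.hasBinaryCoproduct_iff hF]
    constructor
    · rintro ⟨P, s, t, hP⟩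
      -- The dichotomy is whether `H` is constant on nonempty sets.
      by_cases h : ∀ (X : Type u) (p : X),
          Function.Surjective (MonadCoproduct.fmap H fun _ : PUnit => p)
      · exact .inr (.inr (hF.substantiallyExceptional h))
      · push Not at h
        obtain ⟨X, p, hp⟩ := h
        exact .inl (hP.fixpoints hS p hp)
    · rintro (h | h | h)
      · exact MonadCoproduct.exists_isCopair_of_fixpoints h
      · exact MonadCoproduct.exists_isCopair_of_eventually_le hF h.exists_mk_obj_le
      · exact MonadCoproduct.exists_isCopair_of_bounded S (hF.exists_mk_obj_le h)
  · rw [MonadCoproduct.hasBinaryCoproduct_iff hF]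
    exact MonadCoproduct.exists_isCopair_of_eventually_le hF
      ⟨_, fun Z _ hZ => MonadCoproduct.mk_obj_le_of_preservesFilteredColimits S.toFunctor hS hZ⟩
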